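/- Let $K$ be a field, $\sigma\in\mathrm{Aut}(K)$ of finite order $n>1$, $F=\mathrm{Fix}(\sigma)$, and let $R=K[t;\sigma]$ be the skew polynomial ring with $ta=\sigma(a)t$ for $a\in K$; its center is $F[t^n]$. Let $f\in R$ be monic and irreducible of degree $m$ with $(f,t)_r=1$ (that is, every common right divisor of $f$ and $t$ is a unit). Let $h$ be the minimal central left multiple of $f$: $h(t)=\hat h(t^n)$, where $\hat h\in F[x]$ is monic and of least degree among the monic $p\in F[x]$ such that $p(t^n)\in Rf$. Put $E_{\hat h}=F[x]/(\hat h(x))$ and assume $\deg(h)=mn$. Let $V_f=R/Rf$, and for $a\in R$ let $L_a\in\mathrm{End}_F(V_f)$ be the map $L_a(b+Rf)=ab+Rf$, which depends only on $a+Rh$. Let $\rho\in\mathrm{Aut}(K)$, $F'=\mathrm{Fix}(\rho)\cap F$, $\nu\in K$, and let $l$ be a positive integer with $l\le n/2$ and $lm>2$. Put $$S_{n,m,l}(\nu,\rho,f)=\{a+Rh \mid a=d_0+d_1t+\dots+d_{lm-1}t^{lm-1}+\nu\rho(d_0)t^{lm},\ d_i\in K\}\subset R/Rh,$$ and let $\mathcal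 C=\{L_a\mid a+Rh\in S_{n,m,l}(\nu,\rho,f)\}\subset \mathrm{End}_F(V_f)$ be its image. Define $$I_l(\mathcal C)=\{\Phi\in\mathrm{End}_F(V_f)\mid\Phi\,\mathcal C\subseteq\mathcal C\},\qquad I_r(\mathcal C)=\{\Phi\in\mathrm{End}_F(V_f)\mid\mathcal C\,\Phi\subseteq\mathcal C\},$$ $$C(\mathcal C)=\{\Phi\in\mathrm{End}_F(V_f)\mid\Phi M=M\Phi\text{ for all }M\in\mathcal C\},\qquad Z(\mathcal C)=I_l(\mathcal C)\cap C(\mathcal C).$$ Then the following hold, where every isomorphism is a ring isomorphism. The isomorphisms from subfields of $K$ are given by $a\mapsto L_a$, and the one from $E_{\hat h}$ is given by $p+(\hat h)\mapsto L_{p(t^n)}$. If $\nu\neq0$, then (i) $\mathrm{Fix}(\rho)\cong I_l(\mathcal C)$ and $\mathrm{Fix}(\rho^{-1}\circ\sigma^{lm})\cong I_r(\mathcal C)$; (ii) $E_{\hat h}\cong C(\mathcal C)$ and $F'\cong Z(\mathcal C)$. If $\nu=0$, then (iii) $K\cong I_l(\mathcal C)$ and $K\cong I_r(\mathcal C)$;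 (iv) $E_{\hat h}\cong C(\mathcal C)$ and $F\cong Z(\mathcal C)$. -/

import Mathlib

open Polynomial

noncomputable section

namespace SkewCode

variable {K : Type*} [Field K]

/-- The action of `ℕ` on `K` through the powers of `σ`. -/
abbrev powAction (σ : RingAut K) : MulSemiringAction (Multiplicative ℕ) K :=
  MulSemiringAction.compHom K (powersHom (RingAut K) σ)

/-- The skew polynomial ring `K[t;σ]`, with `t a = σ(a) t`: Mathlib's skew polynomials for the
action of `ℕ` on `K` through the powers of `σ`. -/
def SkewPoly (_σ : RingAut K) : Type _ := SkewPolynomial K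

instance instRingSkewPoly (σ : RingAut K) : Ring (SkewPoly σ) :=
  letI := powAction σ
  inferInstanceAs (Ring (SkewPolynomial K))

/-- Constants `K → K[t;σ]`. -/
def const (σ : RingAut K) : K →+* SkewPoly σ :=
  letI := powAction σ
  (SkewPolynomial.CRingHom : K →+* SkewPolynomial K)

/-- The variable `t`. -/
def t (σ : RingAut K) : SkewPoly σ := (SkewPolynomial.X : SkewPolynomial K)

/-- The coefficient of `t ^ i` (coefficients are written on the left). -/
def coeff {σ : RingAut K} (f : SkewPoly σ) (i : ℕ) : K := SkewPolynomial.coeff (R := K) f i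

/-- The degree of a skew polynomial (with value `⊥` for `0`). -/
def degree {σ : RingAut K} (f : SkewPoly σ) : WithBot ℕ := (SkewPolynomial.support (R := K) f).max

/-- The commutation rule `t a = σ(a) t`. -/
theorem t_mul_const (σ : RingAut K) (a : K) : t σ * const σ a = const σ (σ a) * t σ := by
  let := powAction σ
  have h1 : (SkewPolynomial.X : SkewPolynomial K) * SkewPolynomial.C a
      = SkewPolynomial.C (σ a) * SkewPolynomial.X := by
    rw [← SkewPolynomial.monomial_zero_left, SkewPolynomial.X_mul_monomial,
      ← SkewPolynomial.monomial_zero_left, SkewPolynomial.monomial_mul_X]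
    rfl
  exact h1

/-- The fixed field `Fix(τ) = {a ∈ K | τ(a) = a}`. -/
def fixField (τ : RingAut K) : Subfield K := RingHom.eqLocusField τ.toRingHom (RingHom.id K)

/-- Elements of `F = Fix(σ)` are central in `K[t;σ]`. -/
theorem const_comm (σ : RingAut K) (c : fixField σ) (p : SkewPoly σ) :
    const σ c * p = p * const σ c := by
  let := powAction σ
  have hc : ∀ n : ℕ, (SkewPolynomial.φ (R := K))^[n] (c : K) = c := by
    intro n
    exact Function.iterate_fixed (show (SkewPolynomial.φ (R := K)) (c : K) = c from c.2) n
  have key : ∀ q : SkewPolynomial K,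
      SkewPolynomial.C (c : K) * q = q * SkewPolynomial.C (c : K) := by
    intro q
    induction q using SkewPolynomial.induction with
    | h0 => simp
    | ha n r q _ _ ih =>
      rw [mul_add, add_mul, ih, SkewPolynomial.C_mul_monomial, SkewPolynomial.monomial_mul_C, hc,
        mul_comm]
  exact key p

/-- `K[t;σ]` as an algebra over the central subfield `F = Fix(σ)`. -/
instance instAlgebraSkewPoly (σ : RingAut K) : Algebra (fixField σ) (SkewPoly σ) :=
  RingHom.toAlgebra' ((const σ).comp (fixField σ).subtype) (fun c p => const_comm σ c p)

/-- `p(x) ↦ p(t ^ n)`, from `F[x]` to `K[t;σ]`; for `n` the order of `σ` its image `F[t ^ n]` is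
the center of `K[t;σ]`. -/
def evalCentral (σ : RingAut K) : (fixField σ)[X] →ₐ[fixField σ] SkewPoly σ :=
  aeval (t σ ^ orderOf σ)

/-- `f` is monic of degree `m`. -/
def IsMonicOfDegree {σ : RingAut K} (f : SkewPoly σ) (m : ℕ) : Prop :=
  degree f = m ∧ coeff f m = 1

/-- `(f, g)_r = 1`: every common right divisor of `f` and `g` is a unit. -/
def RightCoprime {σ : RingAut K} (f g : SkewPoly σ) : Prop :=
  ∀ d : SkewPoly σ, (∃ a, f = a * d) → (∃ b, g = b * d) → IsUnit d

/-- `h(t) = hHat(t ^ n)` is the minimal central left multiple of `f`, where `n` is the order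
of `σ`: `hHat` is monic and of least degree among the monic `p ∈ F[x]` with `p(t ^ n) ∈ Rf`. -/
def IsMCLM {σ : RingAut K} (f : SkewPoly σ) (hHat : (fixField σ)[X]) : Prop :=
  hHat.Monic ∧ (∃ g, evalCentral σ hHat = g * f) ∧
    ∀ p : (fixField σ)[X], p.Monic → (∃ g, evalCentral σ p = g * f) → hHat.natDegree ≤ p.natDegree

/-- The quotient `R/Rg` of `R = K[t;σ]` by the left ideal `Rg`, as a left `R`-module. -/
abbrev QuotientBy {σ : RingAut K} (g : SkewPoly σ) : Type _ := SkewPoly σ ⧸ Ideal.span {g}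

/-- The left multiplication `L_a(b + Rf) = ab + Rf`, an `F`-linear endomorphism of
`V_f = R/Rf`. -/
def leftMul {σ : RingAut K} (f : SkewPoly σ) :
    SkewPoly σ →ₐ[fixField σ] Module.End (fixField σ) (QuotientBy f) :=
  Algebra.lsmul (fixField σ) (fixField σ) (QuotientBy f)

/-- The set `A` of all `d_0 + d_1 t + ⋯ + d_{k-1} t ^ (k-1) + ν ρ(d_0) t ^ k` with `d_i ∈ K`. -/
def setA (σ ρ : RingAut K) (ν : K) (k : ℕ) : AddSubgroup (SkewPoly σ) where
  carrier := {a | ∃ d : ℕ → K, a =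
    ∑ i ∈ Finset.range k, const σ (d i) * t σ ^ i + const σ (ν * ρ (d 0)) * t σ ^ k}
  zero_mem' := ⟨0, by simp⟩
  add_mem' := by
    rintro _ _ ⟨d, rfl⟩ ⟨e, rfl⟩
    refine ⟨d + e, ?_⟩
    simp only [Pi.add_apply, map_add, add_mul, mul_add, Finset.sum_add_distrib]
    abel
  neg_mem' := by
    rintro _ ⟨d, rfl⟩
    refine ⟨-d, ?_⟩
    simp only [Pi.neg_apply, map_neg, neg_mul, mul_neg, Finset.sum_neg_distrib]
    abel

/-- `S_{n,m,l}(ν,ρ,f) = {a + Rh | a ∈ A} ⊆ R/Rh`, where `h` is the minimal central left multiple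
of `f` (given through `hHat`) and `k = l m`. -/
def setS (σ ρ : RingAut K) (ν : K) (k : ℕ) (hHat : (fixField σ)[X]) :
    AddSubgroup (QuotientBy (evalCentral σ hHat)) :=
  (setA σ ρ ν k).map (Submodule.mkQ (Ideal.span {evalCentral σ hHat})).toAddMonoidHom

/-- The image of a subgroup `S` of `R/Rh` under `a + Rh ↦ L_a`, that is, the set of the `L_a` with
`a ∈ R`, `a + Rh ∈ S`. -/
def code {σ : RingAut K} (f h : SkewPoly σ) (S : AddSubgroup (QuotientBy h)) :
    AddSubgroup (Module.End (fixField σ) (QuotientBy f)) :=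
  (S.comap (Submodule.mkQ (Ideal.span {h})).toAddMonoidHom).map (leftMul f : _ →+ _)

section Idealisers

variable {F V : Type*} [Field F] [AddCommGroup V] [Module F V]

/-- The left idealiser `I_l(𝒞) = {Φ ∈ End_F(V) | Φ𝒞 ⊆ 𝒞}`. -/
def leftIdealiser (𝒞 : AddSubgroup (Module.End F V)) : Subring (Module.End F V) where
  carrier := {Φ | ∀ M ∈ 𝒞, Φ * M ∈ 𝒞}
  one_mem' M hM := by simpa using hM
  mul_mem' {Φ Ψ} hΦ hΨ M hM := by simpa only [mul_assoc] using hΦ _ (hΨ M hM)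
  zero_mem' M _ := by simpa only [zero_mul] using 𝒞.zero_mem
  add_mem' {Φ Ψ} hΦ hΨ M hM := by simpa only [add_mul] using 𝒞.add_mem (hΦ M hM) (hΨ M hM)
  neg_mem' {Φ} hΦ M hM := by simpa only [neg_mul] using 𝒞.neg_mem (hΦ M hM)

/-- The right idealiser `I_r(𝒞) = {Φ ∈ End_F(V) | 𝒞Φ ⊆ 𝒞}`. -/
def rightIdealiser (𝒞 : AddSubgroup (Module.End F V)) : Subring (Module.End F V) where
  carrier := {Φ | ∀ M ∈ 𝒞, M * Φ ∈ 𝒞}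
  one_mem' M hM := by simpa using hM
  mul_mem' {Φ Ψ} hΦ hΨ M hM := by simpa only [mul_assoc] using hΨ _ (hΦ M hM)
  zero_mem' M _ := by simpa only [mul_zero] using 𝒞.zero_mem
  add_mem' {Φ Ψ} hΦ hΨ M hM := by simpa only [mul_add] using 𝒞.add_mem (hΦ M hM) (hΨ M hM)
  neg_mem' {Φ} hΦ M hM := by simpa only [mul_neg] using 𝒞.neg_mem (hΦ M hM)

/-- The centraliser `C(𝒞) = {Φ ∈ End_F(V) | ΦM = MΦ for all M ∈ 𝒞}`. -/
def centraliser (𝒞 : AddSubgroup (Module.End F V)) : Subring (Module.End F V) :=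
  Subring.centralizer (𝒞 : Set (Module.End F V))

/-- The center `Z(𝒞) = I_l(𝒞) ∩ C(𝒞)`. -/
def center (𝒞 : AddSubgroup (Module.End F V)) : Subring (Module.End F V) :=
  leftIdealiser 𝒞 ⊓ centraliser 𝒞

end Idealisers

/-- Left multiplication by constants, `a ↦ L_a`, restricts to a ring isomorphism from the subfield
`k` of `K` onto the subring `T` of `End_F(V_f)`. -/
def IsoByLeftMul {σ : RingAut K} (f : SkewPoly σ) (k : Subfield K)
    (T : Subring (Module.End (fixField σ) (QuotientBy f))) : Prop :=
  ∃ e : k ≃+* T, ∀ a : k, (e a : Module.End (fixField σ) (QuotientBy f)) = leftMul f (const σ a)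

end SkewCode

end

/-! Write `N = l m` and `M = m n`, and let `A` be the set of skew polynomials defining the code. Two
facts about the action of R on V_f carry the proof. By `eq_zero_of_leftMul_eq_zero`, no nonzero skew
polynomial of degree less than `M` kills V_f, so equalities between operators L_a in low degree
become equalities of coefficients; 2l ≤ n leaves room for the products that occur. And L_t is
invertible, because f has nonzero constant term and V_f is finite-dimensional over F.

If Φ lies in the left idealiser, then Φ L_t = L_a with a ∈ A, and a t^j ∈ A for all j ≤ N - 2.
Comparing coefficients leaves a = ct, and cancelling L_t gives Φ = L_c. The right idealiser is
treated in the same way with t^j a. Which constants c occur is decided by the coupling of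
coefficients 0 and N: ρ(c) = c on the left, σ^N(c) = ρ(c) on the right, and no condition if ν = 0.

If Φ centralises the code, it commutes with L_t and L_{ct}, hence with every L_c and with all of R.
Since `hHat` is irreducible (`irreducible_mclm`), E = F[x]/(hHat) is a field acting on V_f, with
dim_E V_f ≤ n. The skew polynomials of degree less than mn embed an F-space of dimension mn² in
End_E(V_f), whose dimension is at most mn². So they fill it, and Φ lies in its center E
(`exists_centralAction_eq`). -/

namespace SkewCode

/-! ### Coefficients of products in K[t;σ]. -/

section Coefficients

variable {K : Type*} [Field K] {σ : RingAut K}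

@[simp] theorem coeff_zero (i : ℕ) : coeff (0 : SkewPoly σ) i = 0 := rfl

@[simp] theorem coeff_add (p q : SkewPoly σ) (i : ℕ) :
    coeff (p + q) i = coeff p i + coeff q i :=
  SkewPolynomial.coeff_add (R := K) p q i

/-- The coefficient of `t ^ i` as an additive map. -/
def coeffHom (σ : RingAut K) (i : ℕ) : SkewPoly σ →+ K where
  toFun p := coeff p i
  map_zero' := rfl
  map_add' p q := coeff_add p q i

@[simp] theorem coeff_sub (p q : SkewPoly σ) (i : ℕ) :
    coeff (p - q) i = coeff p i - coeff q i :=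
  (coeffHom σ i).map_sub p q

@[simp] theorem coeff_sum {ι : Type*} (s : Finset ι) (g : ι → SkewPoly σ) (i : ℕ) :
    coeff (∑ j ∈ s, g j) i = ∑ j ∈ s, coeff (g j) i :=
  map_sum (coeffHom σ i) g s

theorem ext_coeff {p q : SkewPoly σ} (h : ∀ i, coeff p i = coeff q i) : p = q :=
  SkewPolynomial.ext (R := K) h

theorem const_mul_t_pow (a : K) (i : ℕ) :
    const σ a * t σ ^ i = (SkewPolynomial.monomial (R := K) i a : SkewPolynomial K) := by
  let := powAction σ
  exact SkewPolynomial.C_mul_X_pow_eq_monomial (R := K) (a := a) (n := i)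

theorem coeff_const_mul_t_pow (a : K) (i j : ℕ) :
    coeff (const σ a * t σ ^ i) j = if i = j then a else 0 := by
  rw [const_mul_t_pow]
  exact SkewPolynomial.coeff_monomial

theorem induction_terms {P : SkewPoly σ → Prop} (p : SkewPoly σ)
    (hadd : ∀ p q, P p → P q → P (p + q)) (hmono : ∀ a i, P (const σ a * t σ ^ i)) : P p := by
  refine SkewPolynomial.induction (R := K) (motive := P) p ?_ ?_
  · have := hmono 0 0
    rw [map_zero, zero_mul] at this
    exact this
  · intro i a q _ _ hq
    refine hadd _ _ ?_ hq
    rw [← const_mul_t_pow (σ := σ)]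
    exact hmono a i

theorem t_pow_mul_const (i : ℕ) (a : K) :
    t σ ^ i * const σ a = const σ ((σ ^ i) a) * t σ ^ i := by
  induction i generalizing a with
  | zero => simp
  | succ i ih =>
    rw [pow_succ (t σ), mul_assoc, t_mul_const, ← mul_assoc, ih, mul_assoc, pow_succ]
    rfl

theorem coeff_const_mul (a : K) (p : SkewPoly σ) (i : ℕ) :
    coeff (const σ a * p) i = a * coeff p i := by
  induction p using induction_terms with
  | hadd p q hp hq => rw [mul_add, coeff_add, hp, hq, coeff_add, mul_add]
  | hmono b j =>
    rw [← mul_assoc, ← map_mul, coeff_const_mul_t_pow, coeff_const_mul_t_pow]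
    split_ifs <;> simp

theorem coeff_mul_const (p : SkewPoly σ) (a : K) (i : ℕ) :
    coeff (p * const σ a) i = coeff p i * (σ ^ i) a := by
  induction p using induction_terms with
  | hadd p q hp hq => rw [add_mul, coeff_add, hp, hq, coeff_add, add_mul]
  | hmono b j =>
    rw [mul_assoc, t_pow_mul_const, ← mul_assoc, ← map_mul, coeff_const_mul_t_pow,
      coeff_const_mul_t_pow]
    split_ifs with h
    · rw [h]
    · simp

theorem coeff_mul_t_pow (p : SkewPoly σ) (j i : ℕ) :
    coeff (p * t σ ^ j) i = if j ≤ i then coeff p (i - j) else 0 := by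
  induction p using induction_terms with
  | hadd p q hp hq => rw [add_mul, coeff_add, hp, hq, coeff_add]; split_ifs <;> simp
  | hmono b k =>
    rw [mul_assoc, ← pow_add, coeff_const_mul_t_pow, coeff_const_mul_t_pow]
    split_ifs <;> first | rfl | omega

theorem coeff_t_pow_mul (p : SkewPoly σ) (j i : ℕ) :
    coeff (t σ ^ j * p) i = if j ≤ i then (σ ^ j) (coeff p (i - j)) else 0 := by
  induction p using induction_terms with
  | hadd p q hp hq => rw [mul_add, coeff_add, hp, hq, coeff_add]; split_ifs <;> simp
  | hmono b k =>
    rw [← mul_assoc, t_pow_mul_const, mul_assoc, ← pow_add, coeff_const_mul_t_pow,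
      coeff_const_mul_t_pow]
    split_ifs <;> first | rfl | omega | simp

@[simp] theorem coeff_mul_t_succ (p : SkewPoly σ) (i : ℕ) :
    coeff (p * t σ) (i + 1) = coeff p i := by
  simpa using coeff_mul_t_pow p 1 (i + 1)

@[simp] theorem coeff_mul_t_zero (p : SkewPoly σ) : coeff (p * t σ) 0 = 0 := by
  simpa using coeff_mul_t_pow p 1 0

@[simp] theorem coeff_t_mul_succ (p : SkewPoly σ) (i : ℕ) :
    coeff (t σ * p) (i + 1) = σ (coeff p i) := by
  simpa using coeff_t_pow_mul p 1 (i + 1)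

@[simp] theorem coeff_t_mul_zero (p : SkewPoly σ) : coeff (t σ * p) 0 = 0 := by
  simpa using coeff_t_pow_mul p 1 0

theorem coeff_const (a : K) (i : ℕ) : coeff (const σ a) i = if i = 0 then a else 0 := by
  simpa [eq_comm] using coeff_const_mul_t_pow (σ := σ) a 0 i

@[simp] theorem coeff_const_zero (a : K) : coeff (const σ a) 0 = a := by
  simp [coeff_const]

theorem coeff_one (i : ℕ) : coeff (1 : SkewPoly σ) i = if i = 0 then 1 else 0 := by
  rw [← map_one (const σ), coeff_const]

theorem coeff_t (i : ℕ) : coeff (t σ) i = if i = 1 then 1 else 0 := by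
  simpa [eq_comm] using coeff_const_mul_t_pow (σ := σ) 1 1 i

instance : Nontrivial (SkewPoly σ) :=
  ⟨⟨0, 1, fun h => by simpa [coeff_one] using congrArg (fun p => coeff p 0) h⟩⟩

theorem not_isUnit_t : ¬ IsUnit (t σ) := by
  intro h
  obtain ⟨q, hq⟩ := h.exists_right_inv
  simpa [coeff_one] using congrArg (fun p => coeff p 0) hq

theorem t_mul_injective : Function.Injective (fun p : SkewPoly σ => t σ * p) := by
  intro p q h
  refine ext_coeff fun i => ?_
  simpa using congrArg (fun p => coeff p (i + 1)) h

/-! ### Degree bounds, divisibility by t and right division. -/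

/-- The skew polynomials all of whose coefficients from `t ^ k` on vanish. -/
def degreeLT (σ : RingAut K) (k : ℕ) : AddSubgroup (SkewPoly σ) where
  carrier := {p | ∀ i, k ≤ i → coeff p i = 0}
  zero_mem' _ _ := rfl
  add_mem' hp hq i hi := by rw [coeff_add, hp i hi, hq i hi, add_zero]
  neg_mem' {p} hp i hi := by
    rw [show coeff (-p) i = -coeff p i from (coeffHom σ i).map_neg p, hp i hi, neg_zero]

theorem mem_degreeLT {k : ℕ} {p : SkewPoly σ} :
    p ∈ degreeLT σ k ↔ ∀ i, k ≤ i → coeff p i = 0 := Iff.rfl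

theorem degreeLT_mono {k k' : ℕ} (h : k ≤ k') : degreeLT σ k ≤ degreeLT σ k' :=
  fun _ hp i hi => hp i (h.trans hi)

theorem exists_mem_degreeLT (p : SkewPoly σ) : ∃ k, p ∈ degreeLT σ k := by
  induction p using induction_terms with
  | hadd p q hp hq =>
    obtain ⟨i, hi⟩ := hp
    obtain ⟨j, hj⟩ := hq
    exact ⟨max i j, add_mem (degreeLT_mono (le_max_left _ _) hi)
      (degreeLT_mono (le_max_right _ _) hj)⟩
  | hmono a i =>
    refine ⟨i + 1, fun j hj => ?_⟩
    rw [coeff_const_mul_t_pow, if_neg (by omega)]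

theorem mem_degreeLT_of_succ {k : ℕ} {p : SkewPoly σ} (h : p ∈ degreeLT σ (k + 1))
    (h0 : coeff p k = 0) : p ∈ degreeLT σ k := fun i hi => by
  rcases hi.eq_or_lt with rfl | hi
  · exact h0
  · exact h i hi

theorem mem_degreeLT_zero {p : SkewPoly σ} : p ∈ degreeLT σ 0 ↔ p = 0 :=
  ⟨fun h => ext_coeff fun i => h i (Nat.zero_le i), fun h => h ▸ zero_mem _⟩

theorem const_mul_mem_degreeLT {k : ℕ} {p : SkewPoly σ} (a : K) (h : p ∈ degreeLT σ k) :
    const σ a * p ∈ degreeLT σ k := fun i hi => by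
  rw [coeff_const_mul, h i hi, mul_zero]

theorem mul_const_mem_degreeLT {k : ℕ} {p : SkewPoly σ} (a : K) (h : p ∈ degreeLT σ k) :
    p * const σ a ∈ degreeLT σ k := fun i hi => by
  rw [coeff_mul_const, h i hi, zero_mul]

theorem mul_t_pow_mem_degreeLT {k : ℕ} {p : SkewPoly σ} (j : ℕ) (h : p ∈ degreeLT σ k) :
    p * t σ ^ j ∈ degreeLT σ (k + j) := fun i hi => by
  rw [coeff_mul_t_pow, if_pos (by omega), h _ (by omega)]

theorem t_pow_mul_mem_degreeLT {k : ℕ} {p : SkewPoly σ} (j : ℕ) (h : p ∈ degreeLT σ k) :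
    t σ ^ j * p ∈ degreeLT σ (k + j) := fun i hi => by
  rw [coeff_t_pow_mul, if_pos (by omega), h _ (by omega), map_zero]

theorem const_mem_degreeLT (a : K) : const σ a ∈ degreeLT σ 1 := fun i hi => by
  rw [coeff_const, if_neg (by omega)]

theorem t_mem_degreeLT : t σ ∈ degreeLT σ 2 := fun i hi => by
  rw [coeff_t, if_neg (by omega)]

/-- `∑ i < k, d_i t ^ i`. -/
noncomputable def ofCoeffs (σ : RingAut K) (k : ℕ) (d : ℕ → K) : SkewPoly σ :=
  ∑ i ∈ Finset.range k, const σ (d i) * t σ ^ i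

theorem coeff_ofCoeffs (k : ℕ) (d : ℕ → K) (i : ℕ) :
    coeff (ofCoeffs σ k d) i = if i < k then d i else 0 := by
  simp [ofCoeffs, coeff_const_mul_t_pow]

theorem eq_ofCoeffs {k : ℕ} {p : SkewPoly σ} (h : p ∈ degreeLT σ k) :
    p = ofCoeffs σ k (coeff p) := by
  refine ext_coeff fun i => ?_
  rw [coeff_ofCoeffs]
  split_ifs with hi
  · rfl
  · exact h i (by omega)

theorem exists_eq_mul_t (p : SkewPoly σ) (h : coeff p 0 = 0) : ∃ q, p = q * t σ := by
  obtain ⟨k, hk⟩ := exists_mem_degreeLT p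
  refine ⟨ofCoeffs σ k fun i => coeff p (i + 1), ext_coeff fun i => ?_⟩
  cases i with
  | zero => simp [h]
  | succ i =>
    rw [coeff_mul_t_succ, coeff_ofCoeffs]
    split_ifs with hi
    · rfl
    · exact hk _ (by omega)

theorem exists_eq_t_mul (p : SkewPoly σ) (h : coeff p 0 = 0) : ∃ q, p = t σ * q := by
  obtain ⟨k, hk⟩ := exists_mem_degreeLT p
  refine ⟨ofCoeffs σ k fun i => σ⁻¹ (coeff p (i + 1)), ext_coeff fun i => ?_⟩
  cases i with
  | zero => simp [h]
  | succ i =>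
    rw [coeff_t_mul_succ, coeff_ofCoeffs]
    split_ifs with hi
    · exact (σ.apply_symm_apply _).symm
    · rw [map_zero]; exact hk _ (by omega)

/-- Modulo multiples of t on the right only constant terms survive, because t q can be rewritten as
q' t. -/
theorem coeff_mul_zero (p q : SkewPoly σ) : coeff (p * q) 0 = coeff p 0 * coeff q 0 := by
  obtain ⟨p', hp'⟩ := exists_eq_mul_t (p - const σ (coeff p 0)) (by simp)
  rw [sub_eq_iff_eq_add] at hp'
  conv_lhs => rw [hp']
  rw [add_mul, coeff_add, coeff_const_mul, mul_assoc]
  suffices coeff (p' * (t σ * q)) 0 = 0 by rw [this, zero_add]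
  have : ∃ q', t σ * q = q' * t σ := exists_eq_mul_t _ (by simp)
  obtain ⟨q', hq'⟩ := this
  rw [hq', ← mul_assoc, coeff_mul_t_zero]

/-- Every nonzero left-scaling-closed set of skew polynomials has a monic element of least
degree. -/
theorem exists_monic_of_least_degree (S : Set (SkewPoly σ))
    (hS : ∀ a : K, ∀ p ∈ S, const σ a * p ∈ S) {k₀ : ℕ}
    (hne : ∃ p ∈ S, p ≠ 0 ∧ p ∈ degreeLT σ k₀) :
    ∃ k < k₀, ∃ c ∈ S, c ∈ degreeLT σ (k + 1) ∧ coeff c k = 1 ∧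
      ∀ p ∈ S, p ∈ degreeLT σ k → p = 0 := by
  classical
  have hex : ∃ k, ∃ p ∈ S, p ≠ 0 ∧ p ∈ degreeLT σ k := ⟨k₀, hne⟩
  obtain ⟨p, hpS, hp0, hpk⟩ := Nat.find_spec hex
  obtain ⟨k, hk⟩ : ∃ k, Nat.find hex = k + 1 := by
    refine Nat.exists_eq_succ_of_ne_zero fun h => hp0 ?_
    rw [h] at hpk
    exact mem_degreeLT_zero.mp hpk
  have hmin : ∀ p ∈ S, p ∈ degreeLT σ k → p = 0 := by
    intro q hq hqk
    by_contra h0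
    exact Nat.find_min hex (m := k) (by omega) ⟨q, hq, h0, hqk⟩
  rw [hk] at hpk
  have hlead : coeff p k ≠ 0 := fun h => hp0 (hmin p hpS (mem_degreeLT_of_succ hpk h))
  refine ⟨k, ?_, const σ (coeff p k)⁻¹ * p, hS _ _ hpS, const_mul_mem_degreeLT _ hpk, ?_, hmin⟩
  · have := Nat.find_min' hex hne
    omega
  · rw [coeff_const_mul, inv_mul_cancel₀ hlead]

/-- Right division by a monic skew polynomial. -/
theorem exists_eq_mul_add {g : SkewPoly σ} {m : ℕ} (hg : g ∈ degreeLT σ (m + 1))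
    (hg1 : coeff g m = 1) (p : SkewPoly σ) : ∃ q, ∃ r ∈ degreeLT σ m, p = q * g + r := by
  obtain ⟨k, hk⟩ := exists_mem_degreeLT p
  induction k generalizing p with
  | zero => exact ⟨0, p, degreeLT_mono (Nat.zero_le m) hk, by simp⟩
  | succ k ih =>
    rcases le_or_gt (k + 1) m with h | h
    · exact ⟨0, p, degreeLT_mono h hk, by simp⟩
    · obtain ⟨q, r, hr, hqr⟩ := ih (p - const σ (coeff p k) * (t σ ^ (k - m) * g)) (by
        refine mem_degreeLT_of_succ (sub_mem hk (const_mul_mem_degreeLT _ ?_)) ?_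
        · exact degreeLT_mono (by omega) (t_pow_mul_mem_degreeLT (k - m) hg)
        · rw [coeff_sub, coeff_const_mul, coeff_t_pow_mul, if_pos (by omega),
            show k - (k - m) = m by omega, hg1]
          simp)
      refine ⟨q + const σ (coeff p k) * t σ ^ (k - m), r, hr, ?_⟩
      rw [sub_eq_iff_eq_add] at hqr
      rw [add_mul, mul_assoc, add_right_comm]
      exact hqr

theorem mem_degreeLT_of_degree {p : SkewPoly σ} {k : ℕ} (h : degree p = k) :
    p ∈ degreeLT σ (k + 1) := fun i hi => by
  by_contra h0
  have : i ≤ k := Finset.le_max_of_eq (SkewPolynomial.mem_support_iff.mpr h0) h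
  omega

theorem coeff_ne_zero_of_degree {p : SkewPoly σ} {k : ℕ} (h : degree p = k) : coeff p k ≠ 0 :=
  SkewPolynomial.mem_support_iff.mp (Finset.mem_of_max h)

/-! ### The central elements p(t^n) and the defining set of the code. -/

theorem algebraMap_eq (c : fixField σ) : algebraMap (fixField σ) (SkewPoly σ) c = const σ c := rfl

theorem smul_eq_const_mul (c : fixField σ) (p : SkewPoly σ) : c • p = const σ c * p := rfl

theorem mem_fixField {τ : RingAut K} {a : K} : a ∈ fixField τ ↔ τ a = a := Iff.rfl

theorem coeff_evalCentral (hσ : 0 < orderOf σ) (p : (fixField σ)[X]) (i : ℕ) :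
    coeff (evalCentral σ p) i =
      if orderOf σ ∣ i then (p.coeff (i / orderOf σ) : K) else 0 := by
  induction p using Polynomial.induction_on' with
  | add p q hp hq => rw [map_add, coeff_add, hp, hq, Polynomial.coeff_add]; split_ifs <;> simp
  | monomial j c =>
    rw [evalCentral, aeval_monomial, algebraMap_eq, ← pow_mul, coeff_const_mul_t_pow,
      Polynomial.coeff_monomial]
    by_cases hd : orderOf σ ∣ i
    · obtain ⟨k, rfl⟩ := hd
      rw [Nat.mul_div_cancel_left _ hσ]
      simp only [Nat.mul_right_inj hσ.ne', dvd_mul_right, if_true]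
      split_ifs <;> rfl
    · rw [if_neg hd, if_neg]
      rintro rfl
      exact hd (dvd_mul_right _ _)

/-- Moving t^n past a coefficient applies σ^n = 1, and coefficients in F are central. -/
theorem evalCentral_comm (p : (fixField σ)[X]) (q : SkewPoly σ) :
    evalCentral σ p * q = q * evalCentral σ p := by
  induction p using Polynomial.induction_on' with
  | add p p' hp hp' => rw [map_add, add_mul, mul_add, hp, hp']
  | monomial j c =>
    rw [evalCentral, aeval_monomial, algebraMap_eq, ← pow_mul]
    have h1 : t σ ^ (orderOf σ * j) * q = q * t σ ^ (orderOf σ * j) := by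
      refine ext_coeff fun i => ?_
      rw [coeff_t_pow_mul, coeff_mul_t_pow, pow_mul, pow_orderOf_eq_one, one_pow]
      rfl
    rw [mul_assoc, h1, ← mul_assoc, const_comm, mul_assoc]

/-- For k > 0 the top term does not touch the constant coefficient, so d_0 can be read off from a.
-/
theorem mem_setA {ρ : RingAut K} {ν : K} {k : ℕ} (hk : 0 < k) {a : SkewPoly σ} :
    a ∈ setA σ ρ ν k ↔ a ∈ degreeLT σ (k + 1) ∧ coeff a k = ν * ρ (coeff a 0) := by
  constructor
  · rintro ⟨d, rfl⟩
    change ofCoeffs σ k d + _ ∈ _ ∧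
      coeff (ofCoeffs σ k d + _) k = _ * ρ (coeff (ofCoeffs σ k d + _) 0)
    refine ⟨fun i hi => ?_, ?_⟩
    · rw [coeff_add, coeff_ofCoeffs, coeff_const_mul_t_pow, if_neg (by omega), if_neg (by omega),
        add_zero]
    · rw [coeff_add, coeff_add, coeff_ofCoeffs, coeff_ofCoeffs, coeff_const_mul_t_pow,
        coeff_const_mul_t_pow]
      simp [hk, hk.ne']
  · rintro ⟨h1, h2⟩
    refine ⟨coeff a, ?_⟩
    rw [← h2]
    have := eq_ofCoeffs h1
    rwa [ofCoeffs, Finset.sum_range_succ] at this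

end Coefficients

end SkewCode

namespace SkewCode

/-! ### The module R/Rf: the action of t, the annihilator, irreducibility of `hHat`. -/

section CyclicModule

variable {K : Type*} [Field K] {σ : RingAut K} {f : SkewPoly σ}

/-- The class of `b` in `R/Rf`. -/
noncomputable abbrev cls (f : SkewPoly σ) (b : SkewPoly σ) : QuotientBy f :=
  Submodule.Quotient.mk b

theorem cls_surjective (v : QuotientBy f) : ∃ b, cls f b = v :=
  Submodule.Quotient.mk_surjective _ v

theorem cls_eq_zero {b : SkewPoly σ} : cls f b = 0 ↔ ∃ g, b = g * f := by
  rw [Submodule.Quotient.mk_eq_zero, Ideal.mem_span_singleton']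
  simp only [eq_comm]

@[simp] theorem leftMul_cls (a b : SkewPoly σ) : leftMul f a (cls f b) = cls f (a * b) := rfl

theorem cls_eq_leftMul (b : SkewPoly σ) : cls f b = leftMul f b (cls f 1) := by
  rw [leftMul_cls, mul_one]

/-- A central element that kills the generator 1 + Rf kills the whole cyclic module. -/
theorem leftMul_evalCentral_eq_zero {p : (fixField σ)[X]} :
    leftMul f (evalCentral σ p) = 0 ↔ ∃ g, evalCentral σ p = g * f := by
  rw [← cls_eq_zero]
  constructor
  · intro h
    rw [cls_eq_leftMul, h, LinearMap.zero_apply]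
  · intro h
    refine LinearMap.ext fun v => ?_
    obtain ⟨b, rfl⟩ := cls_surjective v
    rw [leftMul_cls, evalCentral_comm, ← leftMul_cls, h, map_zero, LinearMap.zero_apply]

theorem coeff_zero_ne_zero (hft : RightCoprime f (t σ)) :
    coeff f 0 ≠ 0 := fun h =>
  not_isUnit_t (hft _ (exists_eq_mul_t f h) ⟨1, (one_mul _).symm⟩)

/-- If t b = g f, then g_0 f_0 = 0, so g = t g'; cancelling t leaves b = g' f. -/
theorem leftMul_t_injective (hf0 : coeff f 0 ≠ 0) : Function.Injective (leftMul f (t σ)) := by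
  rw [injective_iff_map_eq_zero]
  intro v hv
  obtain ⟨b, rfl⟩ := cls_surjective v
  rw [leftMul_cls, cls_eq_zero] at hv
  obtain ⟨g, hg⟩ := hv
  have h0 : coeff g 0 = 0 := by
    have : coeff (t σ * b) 0 = coeff (g * f) 0 := congrArg (fun p => coeff p 0) hg
    rw [coeff_t_mul_zero, coeff_mul_zero] at this
    exact (mul_eq_zero.mp this.symm).resolve_right hf0
  obtain ⟨g', rfl⟩ := exists_eq_t_mul g h0
  rw [mul_assoc] at hg
  exact cls_eq_zero.mpr ⟨g', t_mul_injective hg⟩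

/-- Artin's theorem for the finite cyclic group generated by σ. -/
theorem finite_and_finrank_eq_orderOf (hσ : 0 < orderOf σ) :
    FiniteDimensional (fixField σ) K ∧ Module.finrank (fixField σ) K = orderOf σ := by
  have hfin : Finite (Subgroup.zpowers σ) := by
    exact Nat.finite_of_card_ne_zero (by rw [Nat.card_zpowers]; exact hσ.ne')
  have := Fintype.ofFinite (Subgroup.zpowers σ)
  have hfix : fixField σ = FixedPoints.subfield (Subgroup.zpowers σ) K := by
    ext a
    rw [mem_fixField]
    constructor
    · rintro ha ⟨g, hg⟩
      have : Subgroup.zpowers σ ≤ MulAction.stabilizer (RingAut K) a :=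
        (Subgroup.zpowers_le).mpr ha
      exact this hg
    · intro ha
      exact ha ⟨σ, Subgroup.mem_zpowers σ⟩
  rw [hfix]
  refine ⟨inferInstance, ?_⟩
  rw [FixedPoints.finrank_eq_card, ← Nat.card_eq_fintype_card, Nat.card_zpowers]

/-- The annihilator of `R/Rf` has no nonzero elements of degree less than `m n`. -/
theorem eq_zero_of_leftMul_eq_zero (hσ : 0 < orderOf σ) (hf0 : coeff f 0 ≠ 0)
    (hsurj : Function.Surjective (leftMul f (t σ))) {m : ℕ}
    (hmin : ∀ p : (fixField σ)[X], p.Monic → (∃ g, evalCentral σ p = g * f) → m ≤ p.natDegree)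
    {a : SkewPoly σ} (ha : a ∈ degreeLT σ (m * orderOf σ)) (h : leftMul f a = 0) : a = 0 := by
  by_contra ha0
  obtain ⟨k, hk, c, hcS, hck, hc1, hleast⟩ := exists_monic_of_least_degree
    {p | leftMul f p = 0} (fun b p (hp : _ = _) => by
      rw [Set.mem_ofPred_eq, map_mul, hp, mul_zero]) ⟨a, h, ha0, ha⟩
  simp only [Set.mem_ofPred_eq] at hcS hleast
  -- Otherwise c = t c', and since L_t is injective c' would be an annihilating element of smaller
  -- degree.
  have hc0 : coeff c 0 ≠ 0 := by
    intro h0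
    obtain ⟨c', rfl⟩ := exists_eq_t_mul c h0
    obtain ⟨k, rfl⟩ : ∃ j, k = j + 1 := by
      refine Nat.exists_eq_succ_of_ne_zero fun hk0 => ?_
      rw [hk0, coeff_t_mul_zero] at hc1
      exact zero_ne_one hc1
    have : c' = 0 := by
      refine hleast c' ?_ fun i hi => ?_
      · refine LinearMap.ext fun v => ?_
        apply leftMul_t_injective hf0
        rw [LinearMap.zero_apply, map_zero, ← Module.End.mul_apply, ← map_mul, hcS,
          LinearMap.zero_apply]
      · have := hck (i + 1) (by omega)
        rwa [coeff_t_mul_succ, map_eq_zero] at this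
    rw [this, mul_zero] at hc1
    exact zero_ne_one hc1
  -- The element c b - σ^k(b) c annihilates and has lost its leading term, so it vanishes. Hence all
  -- σ^i with i in the support of c agree; as 0 is in the support, each is the identity.
  have hconj : ∀ b : K, ∀ i, coeff c i ≠ 0 → (σ ^ i) b = (σ ^ k) b := by
    intro b i hi
    have := hleast (c * const σ b - const σ ((σ ^ k) b) * c)
      (by rw [map_sub, map_mul, map_mul, hcS, zero_mul, mul_zero, sub_zero])
      (mem_degreeLT_of_succ (sub_mem (mul_const_mem_degreeLT _ hck) (const_mul_mem_degreeLT _ hck))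
        (by rw [coeff_sub, coeff_mul_const, coeff_const_mul, hc1, one_mul, mul_one, sub_self]))
    have := congrArg (fun p => coeff p i) this
    rw [coeff_sub, coeff_mul_const, coeff_const_mul, mul_comm, ← sub_mul, coeff_zero] at this
    exact sub_eq_zero.mp ((mul_eq_zero.mp this).resolve_right hi)
  have hdvd : ∀ i, coeff c i ≠ 0 → orderOf σ ∣ i := by
    intro i hi
    refine orderOf_dvd_of_pow_eq_one (RingEquiv.ext fun b => ?_)
    rw [hconj b i hi, ← hconj b 0 hc0, pow_zero]
  -- Write t c - c t = e t. Surjectivity of L_t shows that e annihilates, and its degree is below k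
  -- because c is monic; so e = 0.
  have hfix : ∀ i, coeff c i ∈ fixField σ := by
    intro i
    obtain ⟨e, he⟩ := exists_eq_mul_t (t σ * c - c * t σ) (by simp)
    have hcoeff : ∀ j, coeff e j = σ (coeff c j) - coeff c j := fun j => by
      rw [← coeff_mul_t_succ, ← he, coeff_sub, coeff_t_mul_succ, coeff_mul_t_succ]
    have : e = 0 := by
      refine hleast e ?_ (mem_degreeLT_of_succ (fun i hi => ?_) ?_)
      · refine LinearMap.ext fun v => ?_
        obtain ⟨w, rfl⟩ := hsurj v
        rw [← Module.End.mul_apply, ← map_mul, ← he, map_sub, map_mul, map_mul, hcS]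
        simp
      · rw [hcoeff, hck i hi, map_zero, sub_zero]
      · rw [hcoeff, hc1, map_one, sub_self]
    rw [mem_fixField, ← sub_eq_zero, ← hcoeff, this, coeff_zero]
  obtain ⟨j, rfl⟩ := hdvd k (by rw [hc1]; exact one_ne_zero)
  let p : (fixField σ)[X] :=
    ∑ i ∈ Finset.range (j + 1), monomial i ⟨coeff c (orderOf σ * i), hfix _⟩
  have hp : ∀ i, p.coeff i = if i < j + 1 then ⟨coeff c (orderOf σ * i), hfix _⟩ else 0 := by
    intro i
    simp [p, Polynomial.coeff_monomial]
  have hdeg : p.natDegree ≤ j := Polynomial.natDegree_le_iff_coeff_eq_zero.mpr fun i hi => by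
    rw [hp, if_neg (by omega)]
  have hmonic : p.Monic := Polynomial.monic_of_natDegree_le_of_coeff_eq_one j hdeg (by
    rw [hp, if_pos (by omega)]
    exact Subtype.ext hc1)
  have hpc : evalCentral σ p = c := by
    refine ext_coeff fun i => ?_
    rw [coeff_evalCentral hσ]
    split_ifs with hd
    · obtain ⟨i, rfl⟩ := hd
      rw [Nat.mul_div_cancel_left _ hσ, hp]
      split_ifs with hi
      · rfl
      · rw [hck]
        · rfl
        · have := Nat.mul_le_mul_left (orderOf σ) (not_lt.mp hi)
          rw [mul_add] at this
          omega
    · by_contra h0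
      exact hd (hdvd i (Ne.symm h0))
  have h1 := hmin p hmonic (leftMul_evalCentral_eq_zero.mp (by rw [hpc, hcS]))
  have := Nat.mul_le_mul_left (orderOf σ) (h1.trans hdeg)
  rw [mul_comm m] at hk
  omega

/-- `Rf` is a maximal left ideal for irreducible `f`. -/
theorem le_span_of_irreducible (hirr : Irreducible f) {J : Ideal (SkewPoly σ)} (hfJ : f ∈ J)
    (h1 : (1 : SkewPoly σ) ∉ J) : J ≤ Ideal.span {f} := by
  obtain ⟨k₀, hk₀⟩ := exists_mem_degreeLT f
  obtain ⟨k, -, c, hcJ, hck, hc1, hleast⟩ := exists_monic_of_least_degree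
    (J : Set (SkewPoly σ)) (fun b p hp => J.mul_mem_left _ hp) ⟨f, hfJ, hirr.ne_zero, hk₀⟩
  have hgen : ∀ p ∈ J, ∃ q, p = q * c := by
    intro p hp
    obtain ⟨q, r, hr, hqr⟩ := exists_eq_mul_add hck hc1 p
    have : r = 0 := hleast r (by
      rw [eq_sub_of_add_eq' hqr.symm]
      exact sub_mem hp (J.mul_mem_left _ hcJ)) hr
    exact ⟨q, by rw [hqr, this, add_zero]⟩
  obtain ⟨q, hq⟩ := hgen f hfJ
  -- If c were a unit, J would contain 1.
  have hqu : IsUnit q := (hirr.isUnit_or_isUnit hq).resolve_right fun hu => by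
    obtain ⟨u, hu⟩ := hu.exists_left_inv
    exact h1 (hu ▸ J.mul_mem_left u hcJ)
  obtain ⟨u, hu⟩ := hqu.exists_left_inv
  intro p hp
  obtain ⟨s, rfl⟩ := hgen p hp
  refine Ideal.mem_span_singleton'.mpr ⟨s * u, ?_⟩
  rw [hq, mul_assoc, ← mul_assoc u, hu, one_mul]

/-- Let p(t^n) q(t^n) ∈ Rf with q(t^n) ∉ Rf. The b with b q(t^n) ∈ Rf form a proper left ideal,
which contains f by centrality, so it lies in Rf by maximality; and p(t^n) is such a b. A
factorisation of `hHat` into monic factors of smaller degree would thus contradict minimality. -/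
theorem irreducible_mclm (hirr : Irreducible f) {hHat : (fixField σ)[X]} (h : IsMCLM f hHat)
    (hpos : 0 < hHat.natDegree) :
    Irreducible hHat := by
  have hprime : ∀ p q : (fixField σ)[X], (∃ g, evalCentral σ (p * q) = g * f) →
      (∃ g, evalCentral σ p = g * f) ∨ ∃ g, evalCentral σ q = g * f := by
    intro p q hpq
    by_contra! hcon
    obtain ⟨hp, hq⟩ := hcon
    let J : Ideal (SkewPoly σ) :=
      Submodule.comap (LinearMap.toSpanSingleton (SkewPoly σ) (SkewPoly σ) (evalCentral σ q))
        (Ideal.span {f})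
    have hJ : ∀ b, b ∈ J ↔ ∃ g, b * evalCentral σ q = g * f := fun b => by
      rw [show b ∈ J ↔ _ from Submodule.mem_comap, LinearMap.toSpanSingleton_apply, Ideal.mem_span_singleton']
      simp only [eq_comm, smul_eq_mul]
    have hle := le_span_of_irreducible hirr (J := J)
      ((hJ f).mpr ⟨evalCentral σ q, (evalCentral_comm q f).symm⟩) (fun h1 => by
        obtain ⟨g, hg⟩ := (hJ 1).mp h1
        exact hq g (by rw [← hg, one_mul]))
    obtain ⟨g, hg⟩ := Ideal.mem_span_singleton'.mp
      (hle ((hJ (evalCentral σ p)).mpr (by rwa [← map_mul])))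
    exact hp g hg.symm
  obtain ⟨hmonic, hmem, hmin⟩ := h
  rw [hmonic.irreducible_iff_natDegree']
  refine ⟨?_, fun p q hp hq hpq hmem' => ?_⟩
  · rintro rfl
    simp at hpos
  · rw [Finset.mem_Ioc] at hmem'
    have hsum : hHat.natDegree = p.natDegree + q.natDegree := by
      rw [← hpq, hp.natDegree_mul hq]
    rcases hprime p q (by rwa [hpq]) with hh | hh
    · have := hmin p hp hh
      omega
    · have := hmin q hq hh
      omega

end CyclicModule
end SkewCode

/-! ### The commutant of R on R/Rf, by a dimension count. -/

namespace SkewCode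

/-- If a subspace of `End_E(V)` is large enough to be everything, its commutant consists of the
scalars in `E`. -/
theorem exists_eq_smul_of_commute {F E V W : Type*} [Field F] [Field E] [Algebra F E]
    [AddCommGroup V] [Module F V] [Module E V] [IsScalarTower F E V] [FiniteDimensional F E]
    [FiniteDimensional F V] [AddCommGroup W] [Module F W] {m n : ℕ} (hm : 0 < m)
    (hE : Module.finrank F E = m) (hV : Module.finrank F V ≤ m * n)
    (hW : m * n * n ≤ Module.finrank F W)
    (g : W →ₗ[F] Module.End F V) (hg : Function.Injective g)
    (hgE : ∀ w (e : E) v, g w (e • v) = e • g w v)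
    (Φ : Module.End F V) (hΦ : ∀ w, Φ * g w = g w * Φ) (hΦE : ∀ (e : E) v, Φ (e • v) = e • Φ v) :
    ∃ e : E, ∀ v, Φ v = e • v := by
  have hfinE : FiniteDimensional E V := FiniteDimensional.right F E V
  have hVE : Module.finrank E V ≤ n := by
    rw [← Module.finrank_mul_finrank F E V, hE] at hV
    exact Nat.le_of_mul_le_mul_left hV hm
  let g' : W →ₗ[F] Module.End E V :=
    { toFun w := { toFun := g w, map_add' := map_add _, map_smul' := fun e v => hgE w e v }
      map_add' w w' := by
        refine LinearMap.ext fun v => ?_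
        exact congrArg (fun φ : Module.End F V => φ v) (map_add g w w')
      map_smul' c w := by
        refine LinearMap.ext fun v => ?_
        exact congrArg (fun φ : Module.End F V => φ v) (map_smul g c w) }
  have hg' : Function.Injective g' := fun w w' h => hg <| LinearMap.ext fun v =>
    congrArg (fun φ : Module.End E V => φ v) h
  -- The F-dimension of End_E(V) is m (dim_E V)² ≤ m n², which W already attains; hence `g'` is
  -- onto.
  have hdim : Module.finrank F (Module.End E V) ≤ m * n * n := by
    rw [← Module.finrank_mul_finrank F E (Module.End E V), hE, Module.finrank_linearMap, mul_assoc]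
    exact Nat.mul_le_mul_left _ (Nat.mul_le_mul hVE hVE)
  have : FiniteDimensional F (Module.End E V) := FiniteDimensional.trans F E _
  have hsurj : Function.Surjective g' := by
    rw [← LinearMap.range_eq_top]
    refine Submodule.eq_top_of_finrank_eq (le_antisymm (Submodule.finrank_le _) ?_)
    rw [LinearMap.finrank_range_of_inj hg']
    exact hdim.trans hW
  let Φ' : Module.End E V := { toFun := Φ, map_add' := map_add _, map_smul' := hΦE }
  have hcenter : Φ' ∈ Set.center (Module.End E V) := by
    rw [Semigroup.mem_center_iff]
    intro ψ
    obtain ⟨w, rfl⟩ := hsurj ψ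
    exact LinearMap.ext fun v => (congrArg (fun φ : Module.End F V => φ v) (hΦ w)).symm
  obtain ⟨e, he, hΦe⟩ := Module.End.mem_center_iff.mp hcenter
  exact ⟨e, fun v => congrArg (fun φ : Module.End E V => φ v) hΦe⟩

section CyclicModule

variable {K : Type*} [Field K] {σ : RingAut K} {f : SkewPoly σ}

/-- `(d_i) ↦ ∑ i < k, d_i t ^ i`, as an `F`-linear map. -/
noncomputable def ofFin (σ : RingAut K) (k : ℕ) : (Fin k → K) →ₗ[fixField σ] SkewPoly σ where
  toFun d := ∑ i, const σ (d i) * t σ ^ (i : ℕ)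
  map_add' d e := by simp [add_mul, Finset.sum_add_distrib]
  map_smul' c d := by
    rw [RingHom.id_apply, smul_eq_const_mul, Finset.mul_sum]
    refine Finset.sum_congr rfl fun i _ => ?_
    rw [← mul_assoc, ← map_mul]
    rfl

theorem ofFin_apply (k : ℕ) (d : ℕ → K) : ofFin σ k (fun i => d i) = ofCoeffs σ k d :=
  (Finset.sum_range fun i => const σ (d i) * t σ ^ i).symm

theorem coeff_ofFin (k : ℕ) (d : Fin k → K) (i : ℕ) :
    coeff (ofFin σ k d) i = if h : i < k then d ⟨i, h⟩ else 0 := by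
  have := ofFin_apply (σ := σ) k fun i => if h : i < k then d ⟨i, h⟩ else 0
  simp only [Fin.is_lt, dite_true] at this
  rw [this, coeff_ofCoeffs]
  split_ifs <;> rfl

theorem ofFin_mem_degreeLT (k : ℕ) (d : Fin k → K) : ofFin σ k d ∈ degreeLT σ k := fun i hi => by
  rw [coeff_ofFin, dif_neg (by omega)]

theorem ofFin_injective (k : ℕ) : Function.Injective (ofFin σ k) := fun d e h => by
  ext i
  simpa [coeff_ofFin] using congrArg (fun p => coeff p i) h

/-- `dim_F(R/Rf) ≤ m n` for `f` monic of degree `m`. -/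
theorem finite_and_finrank_quotient_le (hσ : 0 < orderOf σ) {m : ℕ} (hf : f ∈ degreeLT σ (m + 1))
    (hf1 : coeff f m = 1) : FiniteDimensional (fixField σ) (QuotientBy f) ∧
      Module.finrank (fixField σ) (QuotientBy f) ≤ m * orderOf σ := by
  obtain ⟨_, hK⟩ := finite_and_finrank_eq_orderOf hσ
  let g : (Fin m → K) →ₗ[fixField σ] QuotientBy f :=
    { toFun d := cls f (ofFin σ m d)
      map_add' d e := by rw [map_add]; rfl
      map_smul' c d := by rw [map_smul]; rfl }
  have hg : Function.Surjective g := by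
    intro v
    obtain ⟨b, rfl⟩ := cls_surjective v
    obtain ⟨q, r, hr, rfl⟩ := exists_eq_mul_add hf hf1 b
    refine ⟨fun i => coeff r i, ?_⟩
    change cls f (ofFin σ m fun i => coeff r i) = _
    rw [ofFin_apply, ← eq_ofCoeffs hr]
    have h : cls f (q * f) + cls f r = cls f (q * f + r) := rfl
    rw [← h, cls_eq_zero.mpr ⟨q, rfl⟩, zero_add]
  refine ⟨Module.Finite.of_surjective g hg, ?_⟩
  refine (LinearMap.finrank_le_finrank_of_surjective hg).trans ?_
  rw [Module.finrank_pi_fintype, hK, Finset.sum_const, Finset.card_univ, Fintype.card_fin,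
    smul_eq_mul]

/-- The action of `E = F[x]/(hHat)` on `R/Rf`. -/
noncomputable def centralAction (f : SkewPoly σ) (hHat : (fixField σ)[X])
    (h : ∃ g, evalCentral σ hHat = g * f) :
    AdjoinRoot hHat →+* Module.End (fixField σ) (QuotientBy f) :=
  Ideal.Quotient.lift (Ideal.span {hHat})
    ((leftMul f : SkewPoly σ →+* _).comp (evalCentral σ : _ →+* SkewPoly σ)) (by
      intro p hp
      obtain ⟨q, rfl⟩ := Ideal.mem_span_singleton'.mp hp
      change leftMul f (evalCentral σ (q * hHat)) = 0
      rw [map_mul, map_mul, leftMul_evalCentral_eq_zero.mpr h, mul_zero])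

theorem centralAction_mk {hHat : (fixField σ)[X]} (h : ∃ g, evalCentral σ hHat = g * f)
    (p : (fixField σ)[X]) :
    centralAction f hHat h (AdjoinRoot.mk hHat p) = leftMul f (evalCentral σ p) := rfl

/-- The commutant of `R` acting on `R/Rf` is `E = F[x]/(hHat)`. -/
theorem exists_centralAction_eq (hσ : 0 < orderOf σ) {m : ℕ} (hm : 0 < m)
    (hf : f ∈ degreeLT σ (m + 1)) (hf1 : coeff f m = 1) (hHat : (fixField σ)[X])
    (h : ∃ g, evalCentral σ hHat = g * f) (hirr : Irreducible hHat) (hdeg : hHat.natDegree = m)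
    (hinj : ∀ a ∈ degreeLT σ (m * orderOf σ), leftMul f a = 0 → a = 0)
    (Φ : Module.End (fixField σ) (QuotientBy f))
    (hΦ : ∀ a, Φ * leftMul f a = leftMul f a * Φ) : ∃ e, centralAction f hHat h e = Φ := by
  have : Fact (Irreducible hHat) := ⟨hirr⟩
  obtain ⟨_, hK⟩ := finite_and_finrank_eq_orderOf hσ
  obtain ⟨_, hV⟩ := finite_and_finrank_quotient_le hσ hf hf1
  let : Module (AdjoinRoot hHat) (QuotientBy f) :=
    Module.compHom (QuotientBy f) (centralAction f hHat h)
  have hsmul : ∀ (e : AdjoinRoot hHat) (v : QuotientBy f), e • v = centralAction f hHat h e v :=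
    fun _ _ => rfl
  have : IsScalarTower (fixField σ) (AdjoinRoot hHat) (QuotientBy f) := by
    refine ⟨fun c e v => ?_⟩
    obtain ⟨p, rfl⟩ := AdjoinRoot.mk_surjective e
    rw [AdjoinRoot.smul_mk, hsmul, hsmul, centralAction_mk, centralAction_mk, map_smul, map_smul,
      LinearMap.smul_apply]
  have hE : Module.finrank (fixField σ) (AdjoinRoot hHat) = m := by
    rw [(AdjoinRoot.powerBasis hirr.ne_zero).finrank, AdjoinRoot.powerBasis_dim, hdeg]
  have : FiniteDimensional (fixField σ) (AdjoinRoot hHat) :=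
    Module.Finite.of_basis (AdjoinRoot.powerBasis hirr.ne_zero).basis
  -- Commuting with the central operators is E-linearity; this is needed both for the L_a and for Φ.
  have hcomm : ∀ (Ψ : Module.End (fixField σ) (QuotientBy f)),
      (∀ p, Ψ * leftMul f (evalCentral σ p) = leftMul f (evalCentral σ p) * Ψ) →
      ∀ (e : AdjoinRoot hHat) v, Ψ (e • v) = e • Ψ v := by
    intro Ψ hΨ e v
    obtain ⟨p, rfl⟩ := AdjoinRoot.mk_surjective e
    rw [hsmul, hsmul, centralAction_mk]
    exact congrArg (fun φ : Module.End (fixField σ) (QuotientBy f) => φ v) (hΨ _)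
  -- W is the coefficient space of the skew polynomials of degree less than mn; as [K:F] = n, its
  -- F-dimension is mn·n.
  obtain ⟨e, he⟩ := exists_eq_smul_of_commute (E := AdjoinRoot hHat) (n := orderOf σ) hm hE hV
    (W := Fin (m * orderOf σ) → K)
    (by rw [Module.finrank_pi_fintype, hK, Finset.sum_const, Finset.card_univ, Fintype.card_fin,
      smul_eq_mul])
    ((leftMul f).toLinearMap ∘ₗ ofFin σ (m * orderOf σ))
    (by
      rw [injective_iff_map_eq_zero]
      intro d hd
      exact (map_eq_zero_iff _ (ofFin_injective _)).mp (hinj _ (ofFin_mem_degreeLT _ d) hd))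
    (fun d => hcomm (leftMul f (ofFin σ _ d)) fun p => by
      rw [← map_mul, ← map_mul, evalCentral_comm])
    Φ (fun d => hΦ _) (hcomm Φ fun p => hΦ _)
  exact ⟨e, LinearMap.ext fun v => (he v).symm⟩

end CyclicModule
end SkewCode

namespace SkewCode

/-! ### The code, its idealisers and its centraliser. -/

section Code

variable {K : Type*} [Field K] {σ ρ : RingAut K} {f : SkewPoly σ} {ν : K} {N M : ℕ}

/-- Since h acts as zero on V_f, the detour through R/Rh can be dropped. -/
theorem mem_code {hHat : (fixField σ)[X]} (h : ∃ g, evalCentral σ hHat = g * f)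
    {Φ : Module.End (fixField σ) (QuotientBy f)} :
    Φ ∈ code f (evalCentral σ hHat) (setS σ ρ ν N hHat) ↔
      ∃ a ∈ setA σ ρ ν N, leftMul f a = Φ := by
  constructor
  · rintro ⟨a, ⟨a', ha', haa'⟩, rfl⟩
    refine ⟨a', ha', ?_⟩
    have : a' - a ∈ Ideal.span {evalCentral σ hHat} := (Submodule.Quotient.eq _).mp haa'
    obtain ⟨g, hg⟩ := Ideal.mem_span_singleton'.mp this
    change leftMul f a' = leftMul f a
    rw [← sub_eq_zero, ← map_sub, ← hg, map_mul, leftMul_evalCentral_eq_zero.mpr h, mul_zero]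
  · rintro ⟨a, ha, rfl⟩
    exact ⟨a, ⟨a, ha, rfl⟩, rfl⟩

theorem const_mul_t_pow_mem_setA (c : K) {i : ℕ} (hi : 0 < i) (hiN : i < N) :
    const σ c * t σ ^ i ∈ setA σ ρ ν N := by
  rw [mem_setA (by omega), mem_degreeLT]
  simp only [coeff_const_mul_t_pow]
  refine ⟨fun j hj => if_neg (by omega), ?_⟩
  rw [if_neg (by omega), if_neg (by omega), map_zero, mul_zero]

theorem t_pow_mem_setA {i : ℕ} (hi : 0 < i) (hiN : i < N) : t σ ^ i ∈ setA σ ρ ν N := by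
  simpa using const_mul_t_pow_mem_setA (ρ := ρ) (ν := ν) (1 : K) hi hiN

theorem const_mem_setA (c : K) (hN : 0 < N) : const σ c ∈ setA σ ρ (0 : K) N := by
  rw [mem_setA hN]
  refine ⟨degreeLT_mono (by omega) (const_mem_degreeLT c), ?_⟩
  rw [coeff_const, if_neg (by omega), zero_mul]

/-- The witness 1 + ν t^N serves as the test element for constants in the idealisers. -/
theorem exists_mem_setA_coeff_zero_eq_one (ρ : RingAut K) (ν : K) (hN : 0 < N) :
    ∃ a ∈ setA σ ρ ν N, coeff a 0 = 1 := by
  have h0 : coeff (const σ 1 * t σ ^ 0 + const σ ν * t σ ^ N) 0 = 1 := by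
    rw [coeff_add, coeff_const_mul_t_pow, coeff_const_mul_t_pow, if_pos rfl, if_neg hN.ne',
      add_zero]
  refine ⟨_, (mem_setA hN).mpr ⟨fun j hj => ?_, ?_⟩, h0⟩
  · rw [coeff_add, coeff_const_mul_t_pow, coeff_const_mul_t_pow, if_neg (by omega),
      if_neg (by omega), add_zero]
  · rw [h0, coeff_add, coeff_const_mul_t_pow, coeff_const_mul_t_pow, if_neg hN.ne, if_pos rfl,
      zero_add, map_one, mul_one]

/-- For 2 ≤ i < N take j = N - i: then a t^j has coefficient a_i at t^N and constant term 0, so the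
coupling gives a_i = 0. For i = N and i > N the degree bound suffices, with j = 1 and j = 0. -/
theorem coeff_eq_zero_of_mul_t_pow_mem (hN : 3 ≤ N) {a : SkewPoly σ}
    (h : ∀ j, j + 2 ≤ N → a * t σ ^ j ∈ setA σ ρ ν N) {i : ℕ} (hi : 2 ≤ i) : coeff a i = 0 := by
  have hA := fun j hj => (mem_setA (by omega)).mp (h j hj)
  rcases lt_trichotomy i N with hiN | rfl | hiN
  · have := (hA (N - i) (by omega)).2
    rwa [coeff_mul_t_pow, coeff_mul_t_pow, if_pos (by omega), if_neg (by omega), map_zero,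
      mul_zero, show N - (N - i) = i by omega] at this
  · simpa using (hA 1 (by omega)).1 (i + 1) le_rfl
  · simpa using (hA 0 (by omega)).1 i hiN

theorem coeff_eq_zero_of_t_pow_mul_mem (hN : 3 ≤ N) {a : SkewPoly σ}
    (h : ∀ j, j + 2 ≤ N → t σ ^ j * a ∈ setA σ ρ ν N) {i : ℕ} (hi : 2 ≤ i) : coeff a i = 0 := by
  have hA := fun j hj => (mem_setA (by omega)).mp (h j hj)
  rcases lt_trichotomy i N with hiN | rfl | hiN
  · have := (hA (N - i) (by omega)).2
    rwa [coeff_t_pow_mul, coeff_t_pow_mul, if_pos (by omega), if_neg (by omega), map_zero,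
      mul_zero, map_eq_zero, show N - (N - i) = i by omega] at this
  · simpa using (hA 1 (by omega)).1 (i + 1) le_rfl
  · simpa using (hA 0 (by omega)).1 i hiN

theorem coeff_zero_eq_zero_of_mem_setA (hN : 3 ≤ N) (hν : ν ≠ 0) {a : SkewPoly σ}
    (h : a ∈ setA σ ρ ν N) (ha : ∀ i, 2 ≤ i → coeff a i = 0) : coeff a 0 = 0 := by
  have := ((mem_setA (by omega)).mp h).2
  rw [ha N (by omega), eq_comm, mul_eq_zero, map_eq_zero] at this
  exact this.resolve_left hν

theorem eq_const_mul_t {a : SkewPoly σ} (h0 : coeff a 0 = 0) (h2 : ∀ i, 2 ≤ i → coeff a i = 0) :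
    a = const σ (coeff a 1) * t σ := by
  refine ext_coeff fun i => ?_
  match i with
  | 0 => simpa using h0
  | 1 => simp
  | i + 2 => simpa [coeff_const] using h2 (i + 2) (by omega)

section Idealisers

variable (hN : 3 ≤ N) (hNM : 2 * N ≤ M)
  (hinj : ∀ a ∈ degreeLT σ M, leftMul f a = 0 → a = 0)
  (htinj : Function.Injective (leftMul f (t σ)))
  (htsurj : Function.Surjective (leftMul f (t σ)))
  {𝒞 : AddSubgroup (Module.End (fixField σ) (QuotientBy f))}
  (h𝒞 : ∀ Φ, Φ ∈ 𝒞 ↔ ∃ a ∈ setA σ ρ ν N, leftMul f a = Φ)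

include hN hNM hinj h𝒞

/-- R acts faithfully in degrees below M, so membership in the code can be tested on coefficients.
-/
theorem leftMul_mem_iff {a : SkewPoly σ} (ha : a ∈ degreeLT σ M) :
    leftMul f a ∈ 𝒞 ↔ a ∈ setA σ ρ ν N := by
  rw [h𝒞]
  constructor
  · rintro ⟨a', ha', h⟩
    have : a' - a = 0 := by
      refine hinj _ (sub_mem ?_ ha) (by rw [map_sub, h, sub_self])
      exact degreeLT_mono (by omega) ((mem_setA (by omega)).mp ha').1
    rwa [← sub_eq_zero.mp this]
  · exact fun h => ⟨a, h, rfl⟩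

include htsurj in
theorem exists_const_of_mem_leftIdealiser {Φ : Module.End (fixField σ) (QuotientBy f)}
    (hΦ : Φ ∈ leftIdealiser 𝒞) : ∃ c, leftMul f (const σ c) = Φ := by
  have hmul : ∀ a ∈ setA σ ρ ν N, ∃ b ∈ setA σ ρ ν N, leftMul f b = Φ * leftMul f a :=
    fun a ha => (h𝒞 _).mp (hΦ _ ((h𝒞 _).mpr ⟨a, ha, rfl⟩))
  obtain ⟨a, haA, ha⟩ := hmul _ (t_pow_mem_setA (i := 1) one_pos (by omega))
  rw [pow_one] at ha
  have haN := ((mem_setA (by omega)).mp haA).1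
  have h2 : ∀ i, 2 ≤ i → coeff a i = 0 := fun i =>
    coeff_eq_zero_of_mul_t_pow_mem (ρ := ρ) (ν := ν) hN fun j hj => by
      rw [← leftMul_mem_iff hN hNM hinj h𝒞
        (degreeLT_mono (by omega) (mul_t_pow_mem_degreeLT j haN)), map_mul, ha, mul_assoc,
        ← map_mul, ← pow_succ']
      exact hΦ _ ((h𝒞 _).mpr ⟨_, t_pow_mem_setA (by omega) (by omega), rfl⟩)
  have h0 : coeff a 0 = 0 := by
    rcases eq_or_ne ν 0 with rfl | hν
    -- For ν = 0 the coupling says nothing about a_0; but now 1 ∈ A, so Φ = L_b and a = b t.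
    · obtain ⟨b, hbA, hb⟩ := hmul _ (const_mem_setA 1 (by omega))
      rw [map_one, map_one, mul_one] at hb
      have hbN := ((mem_setA (by omega)).mp hbA).1
      have := hinj (b * t σ ^ 1 - a)
        (sub_mem (degreeLT_mono (by omega) (mul_t_pow_mem_degreeLT 1 hbN))
          (degreeLT_mono (by omega) haN))
        (by rw [map_sub, map_mul, hb, pow_one, ha, sub_self])
      rw [← sub_eq_zero.mp this, pow_one, coeff_mul_t_zero]
    · exact coeff_zero_eq_zero_of_mem_setA hN hν haA h2
  refine ⟨coeff a 1, LinearMap.ext fun v => ?_⟩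
  obtain ⟨w, rfl⟩ := htsurj v
  rw [← Module.End.mul_apply, ← Module.End.mul_apply, ← map_mul, ← eq_const_mul_t h0 h2, ha]

include htinj in
theorem exists_const_of_mem_rightIdealiser {Φ : Module.End (fixField σ) (QuotientBy f)}
    (hΦ : Φ ∈ rightIdealiser 𝒞) : ∃ c, leftMul f (const σ c) = Φ := by
  have hmul : ∀ a ∈ setA σ ρ ν N, ∃ b ∈ setA σ ρ ν N, leftMul f b = leftMul f a * Φ :=
    fun a ha => (h𝒞 _).mp (hΦ _ ((h𝒞 _).mpr ⟨a, ha, rfl⟩))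
  obtain ⟨a, haA, ha⟩ := hmul _ (t_pow_mem_setA (i := 1) one_pos (by omega))
  rw [pow_one] at ha
  have haN := ((mem_setA (by omega)).mp haA).1
  have h2 : ∀ i, 2 ≤ i → coeff a i = 0 := fun i =>
    coeff_eq_zero_of_t_pow_mul_mem (ρ := ρ) (ν := ν) hN fun j hj => by
      rw [← leftMul_mem_iff hN hNM hinj h𝒞
        (degreeLT_mono (by omega) (t_pow_mul_mem_degreeLT j haN)), map_mul, ha, ← mul_assoc,
        ← map_mul, ← pow_succ]
      exact hΦ _ ((h𝒞 _).mpr ⟨_, t_pow_mem_setA (by omega) (by omega), rfl⟩)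
  have h0 : coeff a 0 = 0 := by
    rcases eq_or_ne ν 0 with rfl | hν
    · obtain ⟨b, hbA, hb⟩ := hmul _ (const_mem_setA 1 (by omega))
      rw [map_one, map_one, one_mul] at hb
      have hbN := ((mem_setA (by omega)).mp hbA).1
      have := hinj (t σ ^ 1 * b - a)
        (sub_mem (degreeLT_mono (by omega) (t_pow_mul_mem_degreeLT 1 hbN))
          (degreeLT_mono (by omega) haN))
        (by rw [map_sub, map_mul, hb, pow_one, ha, sub_self])
      rw [← sub_eq_zero.mp this, pow_one, coeff_t_mul_zero]
    · exact coeff_zero_eq_zero_of_mem_setA hN hν haA h2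
  -- With c = a_1, ct = t σ⁻¹(c), so the injective L_t cancels on the left.
  refine ⟨σ⁻¹ (coeff a 1), LinearMap.ext fun v => htinj ?_⟩
  rw [← Module.End.mul_apply, ← Module.End.mul_apply, ← map_mul, t_mul_const,
    show σ (σ⁻¹ (coeff a 1)) = coeff a 1 from σ.apply_symm_apply _, ← eq_const_mul_t h0 h2, ha]

/-- Left multiplication by c scales coefficients 0 and N alike, but ρ turns the former factor into
ρ(c). -/
theorem leftMul_const_mem_leftIdealiser_iff (c : K) :
    leftMul f (const σ c) ∈ leftIdealiser 𝒞 ↔ ν = 0 ∨ ρ c = c := by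
  have hiff : ∀ a ∈ setA σ ρ ν N, (leftMul f (const σ c) * leftMul f a ∈ 𝒞 ↔
      ν * (c * ρ (coeff a 0)) = ν * (ρ c * ρ (coeff a 0))) := by
    intro a ha
    obtain ⟨haN, ha0⟩ := (mem_setA (by omega)).mp ha
    have hca := const_mul_mem_degreeLT c haN
    rw [← map_mul, leftMul_mem_iff hN hNM hinj h𝒞 (degreeLT_mono (by omega) hca),
      mem_setA (by omega), and_iff_right hca, coeff_const_mul, coeff_const_mul, ha0, map_mul,
      mul_left_comm]
  constructor
  · intro h
    obtain ⟨a, ha, ha0⟩ := exists_mem_setA_coeff_zero_eq_one (σ := σ) ρ ν (show 0 < N by omega)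
    have := (hiff a ha).mp (h _ ((h𝒞 _).mpr ⟨a, ha, rfl⟩))
    rw [ha0, map_one, mul_one, mul_one, mul_eq_mul_left_iff] at this
    exact this.symm.imp_right Eq.symm
  · intro h Ψ hΨ
    obtain ⟨a, ha, rfl⟩ := (h𝒞 _).mp hΨ
    rw [hiff a ha]
    rcases h with h | h
    · rw [h, zero_mul, zero_mul]
    · rw [h]

/-- Right multiplication by c scales coefficient i by σ^i(c): by c at 0 and by σ^N(c) at N. -/
theorem leftMul_const_mem_rightIdealiser_iff (c : K) :
    leftMul f (const σ c) ∈ rightIdealiser 𝒞 ↔ ν = 0 ∨ (σ ^ N) c = ρ c := by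
  have hiff : ∀ a ∈ setA σ ρ ν N, (leftMul f a * leftMul f (const σ c) ∈ 𝒞 ↔
      ν * (ρ (coeff a 0) * (σ ^ N) c) = ν * (ρ (coeff a 0) * ρ c)) := by
    intro a ha
    obtain ⟨haN, ha0⟩ := (mem_setA (by omega)).mp ha
    have hca := mul_const_mem_degreeLT c haN
    rw [← map_mul, leftMul_mem_iff hN hNM hinj h𝒞 (degreeLT_mono (by omega) hca),
      mem_setA (by omega), and_iff_right hca, coeff_mul_const, coeff_mul_const, ha0, map_mul,
      mul_assoc, pow_zero]
    rfl
  constructor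
  · intro h
    obtain ⟨a, ha, ha0⟩ := exists_mem_setA_coeff_zero_eq_one (σ := σ) ρ ν (show 0 < N by omega)
    have := (hiff a ha).mp (h _ ((h𝒞 _).mpr ⟨a, ha, rfl⟩))
    rw [ha0, map_one, one_mul, one_mul, mul_eq_mul_left_iff] at this
    exact this.symm
  · intro h Ψ hΨ
    obtain ⟨a, ha, rfl⟩ := (h𝒞 _).mp hΨ
    rw [hiff a ha]
    rcases h with h | h
    · rw [h, zero_mul, zero_mul]
    · rw [h]

theorem leftMul_const_mem_centraliser_iff (c : K) :
    leftMul f (const σ c) ∈ centraliser 𝒞 ↔ σ c = c := by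
  constructor
  · intro h
    have := Subring.mem_centralizer_iff.mp h (leftMul f (t σ ^ 1))
      ((h𝒞 _).mpr ⟨_, t_pow_mem_setA one_pos (by omega), rfl⟩)
    rw [← map_mul, ← map_mul, ← sub_eq_zero, ← map_sub] at this
    have := hinj _ (degreeLT_mono (show 3 ≤ M by omega) (sub_mem
      (mul_const_mem_degreeLT _ (by rw [pow_one]; exact degreeLT_mono (by omega) t_mem_degreeLT))
      (const_mul_mem_degreeLT _
        (by rw [pow_one]; exact degreeLT_mono (by omega) t_mem_degreeLT)))) this
    have := congrArg (fun p => coeff p 1) (sub_eq_zero.mp this)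
    simpa [coeff_mul_const, coeff_const_mul, coeff_t] using this
  · intro h
    refine Subring.mem_centralizer_iff.mpr fun Ψ hΨ => ?_
    obtain ⟨a, -, rfl⟩ := (h𝒞 _).mp hΨ
    rw [← map_mul, ← map_mul]
    exact congrArg _ (const_comm σ ⟨c, h⟩ a).symm

omit hNM hinj in
include htsurj in
theorem mul_leftMul_comm_of_mem_centraliser {Φ : Module.End (fixField σ) (QuotientBy f)}
    (hΦ : Φ ∈ centraliser 𝒞) (a : SkewPoly σ) : Φ * leftMul f a = leftMul f a * Φ := by
  have hA : ∀ a ∈ setA σ ρ ν N, Commute Φ (leftMul f a) := fun a ha =>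
    (Subring.mem_centralizer_iff.mp hΦ _ ((h𝒞 _).mpr ⟨a, ha, rfl⟩)).symm
  have ht : Commute Φ (leftMul f (t σ)) := by
    simpa using hA _ (t_pow_mem_setA one_pos (by omega))
  have hc : ∀ c, Commute Φ (leftMul f (const σ c)) := by
    intro c
    -- Constants need not lie in A, but ct does: Φ L_c L_t = L_c L_t Φ = L_c Φ L_t, and the
    -- surjective L_t cancels.
    have := hA _ (const_mul_t_pow_mem_setA c one_pos (by omega))
    rw [pow_one, map_mul, Commute, SemiconjBy, mul_assoc, ← ht.eq, ← mul_assoc,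
      ← mul_assoc] at this
    refine LinearMap.ext fun v => ?_
    obtain ⟨w, rfl⟩ := htsurj v
    exact congrArg (fun φ : Module.End (fixField σ) (QuotientBy f) => φ w) this
  change Commute Φ (leftMul f a)
  induction a using induction_terms with
  | hadd p q hp hq => rw [map_add]; exact hp.add_right hq
  | hmono c i => rw [map_mul, map_pow]; exact (hc c).mul_right (ht.pow_right i)

end Idealisers

/-- Injectivity is automatic, since a ring homomorphism from a field to a nontrivial ring is
injective. -/
theorem isoByLeftMul_of_mem_iff [Nontrivial (Module.End (fixField σ) (QuotientBy f))]
    {k : Subfield K} {T : Subring (Module.End (fixField σ) (QuotientBy f))}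
    (hconst : ∀ Φ ∈ T, ∃ c, leftMul f (const σ c) = Φ)
    (hT : ∀ c, leftMul f (const σ c) ∈ T ↔ c ∈ k) : IsoByLeftMul f k T := by
  let φ : K →+* Module.End (fixField σ) (QuotientBy f) :=
    (leftMul f : SkewPoly σ →+* _).comp (const σ)
  let g : k →+* T := (φ.comp k.subtype).codRestrict T fun c => (hT c).mpr c.2
  refine ⟨RingEquiv.ofBijective g ⟨fun a b h => ?_, ?_⟩, fun _ => rfl⟩
  · exact Subtype.ext (φ.injective (congrArg Subtype.val h))
  · rintro ⟨Φ, hΦ⟩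
    obtain ⟨c, rfl⟩ := hconst Φ hΦ
    exact ⟨⟨c, (hT c).mp hΦ⟩, rfl⟩

end Code

end SkewCode

/-! ### Degree of `hHat` and conclusion. -/

namespace SkewCode

theorem natDegree_eq_of_degree_evalCentral {K : Type*} [Field K] {σ : RingAut K}
    (hσ : 0 < orderOf σ) {p : (fixField σ)[X]} (hp : p.Monic) {m : ℕ}
    (h : degree (evalCentral σ p) = ((m * orderOf σ : ℕ) : WithBot ℕ)) : p.natDegree = m := by
  refine le_antisymm ?_ (Polynomial.le_natDegree_of_ne_zero fun h0 => ?_)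
  · by_contra hlt
    have := mem_degreeLT_of_degree h (p.natDegree * orderOf σ)
      (Nat.mul_lt_mul_of_pos_right (not_le.mp hlt) hσ)
    rw [coeff_evalCentral hσ, if_pos (dvd_mul_left _ _), Nat.mul_div_cancel _ hσ,
      hp.coeff_natDegree] at this
    exact one_ne_zero this
  · refine coeff_ne_zero_of_degree h ?_
    rw [coeff_evalCentral hσ, if_pos (dvd_mul_left _ _), Nat.mul_div_cancel _ hσ, h0]
    rfl

end SkewCode

theorem mainTheorem9 {K : Type*} [Field K] (σ ρ : RingAut K) (n m l : ℕ) (ν : K)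
    (hσ : orderOf σ = n) (hn : 1 < n)
    (f : SkewCode.SkewPoly σ) (hf : SkewCode.IsMonicOfDegree f m) (hirr : Irreducible f)
    (hft : SkewCode.RightCoprime f (SkewCode.t σ))
    (hHat : Polynomial (SkewCode.fixField σ)) (hmclm : SkewCode.IsMCLM f hHat)
    (hdeg : SkewCode.degree (SkewCode.evalCentral σ hHat) = ((m * n : ℕ) : WithBot ℕ))
    (hl : 2 * l ≤ n) (hlm : 2 < l * m)
    (𝒞 : AddSubgroup (Module.End (SkewCode.fixField σ) (SkewCode.QuotientBy f)))
    (h𝒞 : 𝒞 = SkewCode.code f (SkewCode.evalCentral σ hHat)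
      (SkewCode.setS σ ρ ν (l * m) hHat)) :
    (∃ e : AdjoinRoot hHat ≃+* SkewCode.centraliser 𝒞, ∀ p : Polynomial (SkewCode.fixField σ),
      (e (AdjoinRoot.mk hHat p) : Module.End (SkewCode.fixField σ) (SkewCode.QuotientBy f)) =
        SkewCode.leftMul f (SkewCode.evalCentral σ p)) ∧
    (ν ≠ 0 →
      SkewCode.IsoByLeftMul f (SkewCode.fixField ρ) (SkewCode.leftIdealiser 𝒞) ∧
      SkewCode.IsoByLeftMul f (SkewCode.fixField (ρ⁻¹ * σ ^ (l * m))) (SkewCode.rightIdealiser 𝒞) ∧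
      SkewCode.IsoByLeftMul f (SkewCode.fixField ρ ⊓ SkewCode.fixField σ) (SkewCode.center 𝒞)) ∧
    (ν = 0 →
      SkewCode.IsoByLeftMul f ⊤ (SkewCode.leftIdealiser 𝒞) ∧
      SkewCode.IsoByLeftMul f ⊤ (SkewCode.rightIdealiser 𝒞) ∧
      SkewCode.IsoByLeftMul f (SkewCode.fixField σ) (SkewCode.center 𝒞)) := by
  subst hσ
  have hσ0 : 0 < orderOf σ := by omega
  have hfm := SkewCode.mem_degreeLT_of_degree hf.1
  have hm : 0 < m := Nat.pos_of_ne_zero fun h => by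
    rw [h, mul_zero] at hlm
    omega
  have hnat := SkewCode.natDegree_eq_of_degree_evalCentral hσ0 hmclm.1 hdeg
  have htinj := SkewCode.leftMul_t_injective (SkewCode.coeff_zero_ne_zero hft)
  obtain ⟨_, -⟩ := SkewCode.finite_and_finrank_quotient_le hσ0 hfm hf.2
  have htsurj := LinearMap.surjective_of_injective htinj
  have hinj : ∀ a ∈ SkewCode.degreeLT σ (m * orderOf σ), SkewCode.leftMul f a = 0 → a = 0 :=
    fun a ha => SkewCode.eq_zero_of_leftMul_eq_zero hσ0 (SkewCode.coeff_zero_ne_zero hft) htsurj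
      (fun p hp hpf => hnat ▸ hmclm.2.2 p hp hpf) ha
  have hN : 3 ≤ l * m := hlm
  -- This is where 2l ≤ n enters: the products compared above stay in degree less than mn.
  have hNM : 2 * (l * m) ≤ m * orderOf σ := by
    rw [← mul_assoc, mul_comm m]
    exact Nat.mul_le_mul_right m hl
  have hmem : ∀ Φ, Φ ∈ 𝒞 ↔ ∃ a ∈ SkewCode.setA σ ρ ν (l * m), SkewCode.leftMul f a = Φ :=
    fun Φ => by rw [h𝒞, SkewCode.mem_code hmclm.2.1]
  have hirrHat := SkewCode.irreducible_mclm hirr hmclm (hnat ▸ hm)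
  have : Nontrivial (Module.End (SkewCode.fixField σ) (SkewCode.QuotientBy f)) := by
    refine ⟨⟨SkewCode.leftMul f (SkewCode.const σ 1), 0, fun h => ?_⟩⟩
    have := hinj _ (SkewCode.degreeLT_mono (Nat.mul_pos hm hσ0)
      (SkewCode.const_mem_degreeLT 1)) h
    rw [map_one] at this
    exact one_ne_zero this
  have hleft := fun Φ => SkewCode.exists_const_of_mem_leftIdealiser hN hNM hinj htsurj hmem (Φ := Φ)
  have hright := fun Φ =>
    SkewCode.exists_const_of_mem_rightIdealiser hN hNM hinj htinj hmem (Φ := Φ)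
  have hcenter := fun Φ (hΦ : Φ ∈ SkewCode.center 𝒞) => hleft Φ hΦ.1
  have hlc := SkewCode.leftMul_const_mem_leftIdealiser_iff hN hNM hinj hmem
  have hrc := SkewCode.leftMul_const_mem_rightIdealiser_iff hN hNM hinj hmem
  have hcc := SkewCode.leftMul_const_mem_centraliser_iff hN hNM hinj hmem
  refine ⟨?_, fun hν => ⟨?_, ?_, ?_⟩, fun hν => ⟨?_, ?_, ?_⟩⟩
  · have : Fact (Irreducible hHat) := ⟨hirrHat⟩
    let g : AdjoinRoot hHat →+* SkewCode.centraliser 𝒞 :=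
      (SkewCode.centralAction f hHat hmclm.2.1).codRestrict _ fun e => by
        obtain ⟨p, rfl⟩ := AdjoinRoot.mk_surjective e
        refine Subring.mem_centralizer_iff.mpr fun Ψ hΨ => ?_
        obtain ⟨a, -, rfl⟩ := (hmem _).mp hΨ
        rw [SkewCode.centralAction_mk, ← map_mul, ← map_mul, SkewCode.evalCentral_comm]
    refine ⟨RingEquiv.ofBijective g ⟨fun a b h => ?_, ?_⟩, fun p => rfl⟩
    · exact (SkewCode.centralAction f hHat hmclm.2.1).injective (congrArg Subtype.val h)
    · rintro ⟨Φ, hΦ⟩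
      obtain ⟨e, he⟩ := SkewCode.exists_centralAction_eq hσ0 hm hfm hf.2 hHat hmclm.2.1 hirrHat hnat
        hinj Φ (SkewCode.mul_leftMul_comm_of_mem_centraliser hN htsurj hmem hΦ)
      exact ⟨e, Subtype.ext he⟩
  · exact SkewCode.isoByLeftMul_of_mem_iff hleft fun c => (hlc c).trans (or_iff_right hν)
  · refine SkewCode.isoByLeftMul_of_mem_iff hright fun c => ((hrc c).trans (or_iff_right hν)).trans ?_
    -- The condition σ^N(c) = ρ(c) says that c is fixed by ρ⁻¹ ∘ σ^N.
    exact (ρ.symm_apply_eq).symm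
  · refine SkewCode.isoByLeftMul_of_mem_iff hcenter fun c => ?_
    exact and_congr ((hlc c).trans (or_iff_right hν)) (hcc c)
  · exact SkewCode.isoByLeftMul_of_mem_iff hleft fun c =>
      (hlc c).trans (iff_of_true (Or.inl hν) trivial)
  · exact SkewCode.isoByLeftMul_of_mem_iff hright fun c =>
      (hrc c).trans (iff_of_true (Or.inl hν) trivial)
  · refine SkewCode.isoByLeftMul_of_mem_iff hcenter fun c => ?_
    exact (and_iff_right ((hlc c).mpr (Or.inl hν))).trans (hcc c)
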